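/- Let $\overline{\mathbb C}=(\mathbb C,+,-,\cdot,0,1)$ be the field of complex numbers as a first-order structure; "definable" always means definable with parameters. For $X\subseteq\mathbb C^n$ defined in $\overline{\mathbb C}$ by a formula $\varphi$ with parameters from $\mathbb C$, the dimension $\dim X$ is the largest $d$ such that, in some elementary extension $N$ of $\overline{\mathbb C}$, there are a tuple $(a_1,\dots,a_n)$ satisfying $\varphi$ and indices $i_1,\dots,i_d$ with $a_{i_{j}}\notin\operatorname{acl}(\mathbb C\cup\{a_{i_1},\dots,a_{i_{j-1}}\})$ for $1\le j\le d$, where $\operatorname{acl}(C)$ denotes the union of all finite subsets of $N$ definable in $N$ with parameters from $C$ (and $\dim\emptyset=-\infty$). Let $\mathcal C(\overline{\mathbb C}_{\mathbb C})$ be the relational structure with universe $\mathbb C$ whose basic relations are, for all $n$, the subsets of $\mathbb C^n$ that are definable in $\overline{\mathbb C}$ and of dimension at most $1$. Let $\mathcal B(\overline{\mathbb C}_{\mathbb C})$ be the relational structure with universe $\mathbb C$ whose basic relations are all subsets of $\mathbb C^2$ that are definable in $\overline{\mathbb C}$. A structure $\mathcal S$ with universe $\mathbb C$ is called a proper reduct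 of $\overline{\mathbb C}$ if, for every $n$, every subset of $\mathbb C^n$ definable in $\mathcal S$ is definable in $\overline{\mathbb C}$, while for some $n$ there is a subset of $\mathbb C^n$ definable in $\overline{\mathbb C}$ that is not definable in $\mathcal S$. Then $\mathcal C(\overline{\mathbb C}_{\mathbb C})$ is a proper reduct of $\overline{\mathbb C}$, and so is $\mathcal B(\overline{\mathbb C}_{\mathbb C})$. -/

import Mathlib

namespace CurveReduct

open scoped FirstOrder

/-- The field of complex numbers as a first-order structure in the language of rings. -/
noncomputable instance complexRing : FirstOrder.Ring.CompatibleRing ℂ :=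
  FirstOrder.Ring.compatibleRingOfRing ℂ

/-- The model-theoretic algebraic closure `acl(C)` in the structure `N`: the elements which lie in
some finite subset of `N` that is definable with parameters from `C`. -/
def acl (L : FirstOrder.Language.{0, 0}) {N : Type} [L.Structure N] (C : Set N) : Set N :=
  {b | ∃ s : Set N, C.Definable₁ L s ∧ s.Finite ∧ b ∈ s}

/-- The formula `φ` in `n` free variables, with parameters from `M`, admits an independent
sequence of length `d`: in some elementary extension `N` of `M` there is a tuple `a` satisfying
`φ`, and a subtuple of `a` of length `d` none of whose entries is algebraic over `M` together with
the preceding entries of the subtuple. -/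
def HasIndep (L : FirstOrder.Language.{0, 0}) {M : Type} [L.Structure M] {n : ℕ}
    (φ : L.Formula (M ⊕ Fin n)) (d : ℕ) : Prop :=
  ∃ (N : Type) (_ : L.Structure N) (f : M ↪ₑ[L] N) (a : Fin n → N) (i : Fin d → Fin n),
    φ.Realize (Sum.elim f a) ∧
      ∀ j : Fin d, a (i j) ∉ acl L (Set.range f ∪ {b | ∃ k < j, b = a (i k)})

/-- The `acl`-dimension of (the set defined by) `φ` is at most `m`. -/
def DimLE (L : FirstOrder.Language.{0, 0}) {M : Type} [L.Structure M] {n : ℕ}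
    (φ : L.Formula (M ⊕ Fin n)) (m : ℕ) : Prop :=
  ∀ d : ℕ, HasIndep L φ d → d ≤ m

/-- `X ⊆ Mⁿ` is an (`M`-definable) `n`-curve: it is definable with parameters from `M`, of
dimension at most one. -/
def IsCurve (L : FirstOrder.Language.{0, 0}) {M : Type} [L.Structure M] {n : ℕ}
    (X : Set (Fin n → M)) : Prop :=
  ∃ φ : L.Formula (M ⊕ Fin n), (∀ x, x ∈ X ↔ φ.Realize (Sum.elim id x)) ∧ DimLE L φ 1

/-- The relational language with an `n`-ary predicate for each `n`-curve of `M`, for every `n`. -/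
def curveLang (L : FirstOrder.Language.{0, 0}) (M : Type) [L.Structure M] : FirstOrder.Language.{0, 0} where
  Functions _ := Empty
  Relations n := {X : Set (Fin n → M) // IsCurve L X}

/-- The structure `𝒞(M_M)`: each predicate is interpreted by the corresponding curve. -/
instance curveStructure (L : FirstOrder.Language.{0, 0}) (M : Type) [L.Structure M] :
    (curveLang L M).Structure M where
  funMap f := Empty.elim f
  RelMap r x := x ∈ r.1

/-- The relational language with a binary predicate for each subset of `M²` definable in `M` with
parameters from `M`, and no other symbols. -/
def binaryLang (L : FirstOrder.Language.{0, 0}) (M : Type) [L.Structure M] : FirstOrder.Language.{0, 0} where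
  Functions _ := Empty
  Relations n := {X : Set (Fin n → M) // n = 2 ∧ (Set.univ : Set M).Definable L X}

/-- The structure `ℬ(M_M)`: each predicate is interpreted by the corresponding binary relation. -/
instance binaryStructure (L : FirstOrder.Language.{0, 0}) (M : Type) [L.Structure M] :
    (binaryLang L M).Structure M where
  funMap f := Empty.elim f
  RelMap r x := x ∈ r.1

/-- The `L₁`-structure on `M` is a reduct, in the sense of definability, of the `L₂`-structure on
`M`: every subset of a finite power of `M` which is definable (with parameters) in the former is
definable (with parameters) in the latter. -/
def IsReduct (L₁ L₂ : FirstOrder.Language.{0, 0}) (M : Type) [L₁.Structure M] [L₂.Structure M] : Prop :=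
  ∀ (n : ℕ) (X : Set (Fin n → M)),
    (Set.univ : Set M).Definable L₁ X → (Set.univ : Set M).Definable L₂ X

/-- A proper reduct: a reduct which defines strictly fewer sets. -/
def IsProperReduct (L₁ L₂ : FirstOrder.Language.{0, 0}) (M : Type) [L₁.Structure M] [L₂.Structure M] :
    Prop :=
  IsReduct L₁ L₂ M ∧ ¬ IsReduct L₂ L₁ M

end CurveReduct

/-! Both structures fail to define the graph of addition. Take an elementary extension `K` of ℂ with
independent `c`, `b` over ℂ, an automorphism `τ` of `K` over ℂ with `τ c = c + 1`, and the algebraic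
closure `E` of ℂ(c) in `K`, which `τ` preserves. Let σ be `τ` on `E` and the identity off `E`
(`permOn`). Then σ does not respect addition: `c - b` and `b` lie off `E` and are fixed, while their
sum `c` moves.

Yet σ agrees with a field automorphism on every pair (`exists_algEquiv_eq_permOn`), because
independent pairs are conjugate, and on every tuple of pairwise dependent entries
(`exists_algEquiv_eq_permOn_of_dependent`), in particular on points of curves. So σ preserves the
basic relations of both structures as interpreted in `K`, and fixes ℂ. A definition of addition over
ℂ would translate into a ring formula (`exists_translation`), pass to `K` by elementarity, and be
preserved by σ, a contradiction. -/

namespace CurveReduct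

open Cardinal AlgebraicIndependent

/-! ### Conjugacy of algebraically independent families -/

section Automorphisms

variable {k K : Type} [Field k] [Field K] [Algebra k K] [IsAlgClosed K]

/-- A bijection between transcendence bases extends to an automorphism. -/
theorem exists_algEquiv_of_isTranscendenceBasis {ι κ : Type} {v : ι → K} {w : κ → K}
    (hv : IsTranscendenceBasis k v) (hw : IsTranscendenceBasis k w) (e : ι ≃ κ) :
    ∃ g : K ≃ₐ[k] K, ∀ i, g (v i) = w (e i) := by
  -- `K` is an algebraic closure of both polynomial rings k[v] and k[w], so an isomorphism between
  -- them extends to `K`.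
  let := IsAlgClosed.isAlgClosure_of_transcendence_basis v hv
  let := IsAlgClosed.isAlgClosure_of_transcendence_basis w hw
  let e' : Algebra.adjoin k (Set.range v) ≃ₐ[k] Algebra.adjoin k (Set.range w) :=
    hv.1.aevalEquiv.symm.trans ((MvPolynomial.renameEquiv k e).trans hw.1.aevalEquiv)
  let g : K ≃+* K := IsAlgClosure.equivOfEquiv K K e'.toRingEquiv
  have hg (x) : g (algebraMap (Algebra.adjoin k (Set.range v)) K x) = e' x :=
    IsAlgClosure.equivOfEquiv_algebraMap K K e'.toRingEquiv x
  refine ⟨AlgEquiv.ofRingEquiv (f := g) fun r ↦ ?_, fun i ↦ ?_⟩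
  · simpa using hg (algebraMap k _ r)
  · have h := hg (hv.1.aevalEquiv (MvPolynomial.X i))
    simpa [e'] using h

/-- Any two finite algebraically independent families indexed by the same type are conjugate under
automorphisms of an algebraically closed field. -/
theorem exists_algEquiv_of_algebraicIndependent {ι : Type} [Finite ι] {v w : ι → K}
    (hv : AlgebraicIndependent k v) (hw : AlgebraicIndependent k w) :
    ∃ g : K ≃ₐ[k] K, ∀ i, g (v i) = w i := by
  obtain ⟨B, hvB, hB⟩ := exists_isTranscendenceBasis_superset hv.to_subtype_range
  obtain ⟨C, hwC, hC⟩ := exists_isTranscendenceBasis_superset hw.to_subtype_range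
  let s : Set B := Set.range fun i ↦ (⟨v i, hvB ⟨i, rfl⟩⟩ : B)
  have hinj : Function.Injective fun i ↦ (⟨v i, hvB ⟨i, rfl⟩⟩ : B) := fun i j h ↦
    hv.injective (congrArg Subtype.val h)
  let ev : ι ≃ s := Equiv.ofInjective _ hinj
  let f : s ↪ C := ⟨fun x ↦ ⟨w (ev.symm x), hwC ⟨_, rfl⟩⟩, fun x y h ↦
    ev.symm.injective (hw.injective (congrArg Subtype.val h))⟩
  have hBC : Nonempty (B ≃ C) := Cardinal.eq.1 (hB.cardinalMk_eq hC)
  have hs : s.Finite := Set.finite_range _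
  obtain ⟨e, he⟩ : ∃ e : B ≃ C, ∀ x : s, e x = f x := by
    -- The partial injection has finite domain, so it extends to a bijection of the equipotent bases
    -- even when they are infinite.
    cases finite_or_infinite B
    · exact extend_function_finite f hBC
    · exact extend_function_of_lt f (hs.lt_aleph0.trans_le (aleph0_le_mk B)) hBC
  obtain ⟨g, hg⟩ := exists_algEquiv_of_isTranscendenceBasis hB hC e
  refine ⟨g, fun i ↦ ?_⟩
  have h := hg ⟨v i, hvB ⟨i, rfl⟩⟩
  have h' := he (ev i)
  have hf : (f (ev i) : K) = w i := congrArg w (ev.symm_apply_apply i)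
  exact h.trans ((congrArg Subtype.val h').trans hf)

/-- `Indep₂ k x y` means that `x`, `y` is an algebraically independent pair over `k`. -/
def Indep₂ (k : Type) {K : Type} [Field k] [Field K] [Algebra k K] (x y : K) : Prop :=
  x ∉ (matroid k K).closure ∅ ∧ y ∉ (matroid k K).closure {x}

omit [IsAlgClosed K] in
theorem Indep₂.algebraicIndependent {x y : K} (h : Indep₂ k x y) :
    AlgebraicIndependent k ![x, y] := by
  have hx : (matroid k K).Indep {x} := by
    have h1 := (matroid k K).empty_indep.insert_indep_iff (e := x)
    simpa [h.1] using h1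
  have hxy : (matroid k K).Indep {y, x} := by
    have h1 := hx.insert_indep_iff (e := y)
    simpa [h.2] using h1
  have hne : x ≠ y := by
    rintro rfl
    exact h.2 ((matroid k K).mem_closure_of_mem (Set.mem_singleton x))
  rw [matroid_indep_iff] at hxy
  have hinj : Function.Injective ![x, y] := by
    intro i j; fin_cases i <;> fin_cases j <;> simp [hne, hne.symm]
  refine AlgebraicIndependent.of_subtype_range hinj ?_
  have : Set.range ![x, y] = {y, x} := by
    simp
  rw [this]
  exact hxy

theorem exists_algEquiv_of_indep₂ {x y x' y' : K} (h : Indep₂ k x y) (h' : Indep₂ k x' y') :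
    ∃ g : K ≃ₐ[k] K, g x = x' ∧ g y = y' := by
  obtain ⟨g, hg⟩ :=
    exists_algEquiv_of_algebraicIndependent h.algebraicIndependent h'.algebraicIndependent
  exact ⟨g, hg 0, hg 1⟩

omit [IsAlgClosed K] in
theorem coe_mem_closure (s : Set K) (r : k) : algebraMap k K r ∈ (matroid k K).closure s := by
  rw [matroid_closure_eq]
  exact isAlgebraic_algebraMap (algebraMap k (Algebra.adjoin k s) r)

omit [IsAlgClosed K] in
theorem mem_closure_empty [IsAlgClosed k] {x : K} :
    x ∈ (matroid k K).closure ∅ ↔ x ∈ Set.range (algebraMap k K) := by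
  refine ⟨fun h ↦ ?_, ?_⟩
  · rw [matroid_closure_eq, SetLike.mem_coe, Subalgebra.mem_algebraicClosure, Algebra.adjoin_empty] at h
    have hx : IsIntegral k x := (Subalgebra.isAlgebraic_of_isAlgebraic_bot h).isIntegral
    have : Algebra.IsAlgebraic k (IntermediateField.adjoin k {x}) :=
      IntermediateField.isAlgebraic_adjoin_simple hx
    have hbot := (IntermediateField.adjoin k {x}).eq_bot_of_isAlgClosed_of_isAlgebraic
    exact IntermediateField.mem_bot.1 (hbot ▸ IntermediateField.mem_adjoin_simple_self k x)
  · rintro ⟨r, rfl⟩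
    exact coe_mem_closure _ _

omit [IsAlgClosed K] in
theorem add_mem_closure {s : Set K} {x y : K} (hx : x ∈ (matroid k K).closure s)
    (hy : y ∈ (matroid k K).closure s) : x + y ∈ (matroid k K).closure s := by
  rw [matroid_closure_eq] at *
  exact add_mem hx hy

omit [IsAlgClosed K] in
theorem neg_mem_closure {s : Set K} {x : K} (hx : x ∈ (matroid k K).closure s) :
    -x ∈ (matroid k K).closure s := by
  rw [matroid_closure_eq] at *
  exact neg_mem hx

omit [IsAlgClosed K] in
theorem add_coe_mem_closure_iff {s : Set K} {x : K} {r : k} :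
    x + algebraMap k K r ∈ (matroid k K).closure s ↔ x ∈ (matroid k K).closure s := by
  refine ⟨fun h ↦ ?_, fun h ↦ add_mem_closure h (coe_mem_closure s r)⟩
  simpa using add_mem_closure h (neg_mem_closure (coe_mem_closure s r))

omit [IsAlgClosed K] in
theorem closure_singleton_add_coe (x : K) (r : k) :
    (matroid k K).closure {x + algebraMap k K r} = (matroid k K).closure {x} := by
  refine subset_antisymm ?_ ?_ <;> refine Matroid.closure_subset_closure_of_subset_closure ?_ <;>
    rw [Set.singleton_subset_iff]
  · exact add_coe_mem_closure_iff.2 (Matroid.mem_closure_of_mem _ rfl)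
  · exact add_coe_mem_closure_iff.1 (Matroid.mem_closure_of_mem _ (Set.mem_singleton _))

omit [IsAlgClosed K] in
theorem Indep₂.add_coe {x y : K} (h : Indep₂ k x y) (r s : k) :
    Indep₂ k (x + algebraMap k K r) (y + algebraMap k K s) := by
  rw [Indep₂, closure_singleton_add_coe, add_coe_mem_closure_iff, add_coe_mem_closure_iff]
  exact h

end Automorphisms
end CurveReduct

namespace CurveReduct

open Cardinal AlgebraicIndependent

/-! ### Gluing an automorphism on a closed set to the identity -/

section PartialAutomorphism

variable {k K : Type} [Field k] [Field K] [Algebra k K]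

theorem apply_mem_closure (g : K ≃ₐ[k] K) {x y : K} (h : y ∈ (matroid k K).closure {x}) :
    g y ∈ (matroid k K).closure {g x} := by
  rw [matroid_closure_eq, SetLike.mem_coe, Subalgebra.mem_algebraicClosure] at *
  have hmap : (Algebra.adjoin k {x}).map (g : K →ₐ[k] K) = Algebra.adjoin k {g x} := by
    simp [AlgHom.map_adjoin]
  let e : Algebra.adjoin k {x} ≃ₐ[k] Algebra.adjoin k {g x} :=
    (g.subalgebraMap (Algebra.adjoin k {x})).trans (Subalgebra.equivOfEq _ _ hmap)
  exact IsAlgebraic.ringHom_of_comp_eq e g h e.injective rfl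

theorem closure_singleton_subset {x c : K} (h : x ∈ (matroid k K).closure {c}) :
    (matroid k K).closure {x} ⊆ (matroid k K).closure {c} :=
  Matroid.closure_subset_closure_of_subset_closure (Set.singleton_subset_iff.2 h)

/-- The permutation of `α` which agrees with `τ` on the invariant set `E`, and is the identity
elsewhere. -/
noncomputable def permOn {α : Type} (τ : Equiv.Perm α) (E : Set α) (h : ∀ x, τ x ∈ E ↔ x ∈ E) :
    Equiv.Perm α := by
  classical exact (τ.subtypePerm h).ofSubtype

theorem permOn_of_mem {α : Type} {τ : Equiv.Perm α} {E : Set α} {h : ∀ x, τ x ∈ E ↔ x ∈ E} {x : α}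
    (hx : x ∈ E) : permOn τ E h x = τ x := by
  classical exact Equiv.Perm.ofSubtype_apply_of_mem (τ.subtypePerm h) hx

theorem permOn_of_notMem {α : Type} {τ : Equiv.Perm α} {E : Set α} {h : ∀ x, τ x ∈ E ↔ x ∈ E}
    {x : α} (hx : x ∉ E) : permOn τ E h x = x := by
  classical exact Equiv.Perm.ofSubtype_apply_of_not_mem (τ.subtypePerm h) hx

theorem permOn_symm_of_mem {α : Type} {τ : Equiv.Perm α} {E : Set α} {h : ∀ x, τ x ∈ E ↔ x ∈ E}
    {x : α} (hx : x ∈ E) : (permOn τ E h).symm x = τ.symm x := by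
  rw [Equiv.symm_apply_eq, permOn_of_mem (by simpa using (h (τ.symm x)).1 (by simpa using hx))]
  simp

theorem permOn_symm_of_notMem {α : Type} {τ : Equiv.Perm α} {E : Set α}
    {h : ∀ x, τ x ∈ E ↔ x ∈ E} {x : α} (hx : x ∉ E) : (permOn τ E h).symm x = x := by
  rw [Equiv.symm_apply_eq, permOn_of_notMem hx]

variable [IsAlgClosed k] {τ : K ≃ₐ[k] K} {c : K}
  {h : ∀ x, τ x ∈ (matroid k K).closure {c} ↔ x ∈ (matroid k K).closure {c}}

theorem apply_eq_of_mem_closure_empty (g : K ≃ₐ[k] K) {x : K} (hx : x ∈ (matroid k K).closure ∅) :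
    g x = x := by
  obtain ⟨r, rfl⟩ := mem_closure_empty.1 hx
  exact g.commutes r

theorem permOn_closure_of_mem_closure_empty {x : K} (hx : x ∈ (matroid k K).closure ∅) :
    permOn τ.toEquiv _ h x = x := by
  rw [permOn_of_mem ((matroid k K).closure_subset_closure (Set.empty_subset _) hx)]
  exact apply_eq_of_mem_closure_empty τ hx

theorem permOn_coe (r : k) : permOn τ.toEquiv _ h (algebraMap k K r) = algebraMap k K r :=
  permOn_closure_of_mem_closure_empty (coe_mem_closure _ _)

omit [IsAlgClosed k] in
theorem indep₂_of_mem_of_notMem {x y : K} (hx : x ∈ (matroid k K).closure {c})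
    (hx' : x ∉ (matroid k K).closure ∅) (hy : y ∉ (matroid k K).closure {c}) : Indep₂ k x y :=
  ⟨hx', fun hxy ↦ hy (closure_singleton_subset hx hxy)⟩

/-- Either `x` lies in `k` and nothing moves, or both `(x, y)` and `(τ x, y)` are independent pairs
and hence conjugate. -/
theorem exists_algEquiv_eq_permOn_of_mem_of_notMem [IsAlgClosed K] {x y : K}
    (hx : x ∈ (matroid k K).closure {c}) (hy : y ∉ (matroid k K).closure {c}) :
    ∃ g : K ≃ₐ[k] K, g x = permOn τ.toEquiv _ h x ∧ g y = permOn τ.toEquiv _ h y := by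
  rw [permOn_of_notMem hy]
  by_cases hx' : x ∈ (matroid k K).closure ∅
  · exact ⟨AlgEquiv.refl, (permOn_closure_of_mem_closure_empty hx').symm, rfl⟩
  rw [permOn_of_mem hx]
  refine exists_algEquiv_of_indep₂ (indep₂_of_mem_of_notMem hx hx' hy)
    (indep₂_of_mem_of_notMem ((h x).2 hx) (fun hτ ↦ hx' ?_) hy)
  obtain ⟨r, hr⟩ := mem_closure_empty.1 hτ
  refine mem_closure_empty.2 ⟨r, τ.injective ?_⟩
  rw [τ.commutes]
  exact hr

/-- On each pair of elements, `permOn τ` agrees with a field automorphism. -/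
theorem exists_algEquiv_eq_permOn [IsAlgClosed K] (x y : K) :
    ∃ g : K ≃ₐ[k] K, g x = permOn τ.toEquiv _ h x ∧ g y = permOn τ.toEquiv _ h y := by
  by_cases hx : x ∈ (matroid k K).closure {c} <;> by_cases hy : y ∈ (matroid k K).closure {c}
  · exact ⟨τ, (permOn_of_mem hx).symm, (permOn_of_mem hy).symm⟩
  · exact exists_algEquiv_eq_permOn_of_mem_of_notMem hx hy
  · obtain ⟨g, hg, hg'⟩ := exists_algEquiv_eq_permOn_of_mem_of_notMem (h := h) hy hx
    exact ⟨g, hg', hg⟩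
  · exact ⟨AlgEquiv.refl, (permOn_of_notMem hx).symm, (permOn_of_notMem hy).symm⟩

/-- On each tuple of pairwise dependent elements, `permOn τ` and its inverse agree with a field
automorphism and its inverse. -/
theorem exists_algEquiv_eq_permOn_of_dependent {ι : Type} {x : ι → K}
    (hx : ∀ i j, ¬ Indep₂ k (x i) (x j)) :
    ∃ g : K ≃ₐ[k] K, (∀ i, g (x i) = permOn τ.toEquiv _ h (x i)) ∧
      ∀ i, g.symm (x i) = (permOn τ.toEquiv _ h).symm (x i) := by
  by_cases hE : ∀ i, x i ∈ (matroid k K).closure {c}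
  · exact ⟨τ, fun i ↦ (permOn_of_mem (hE i)).symm, fun i ↦ (permOn_symm_of_mem (hE i)).symm⟩
  obtain ⟨j, hj⟩ := not_forall.1 hE
  -- Since `x j` lies outside the closure of `c`, an entry inside it that is transcendental over `k`
  -- would be independent from `x j`. Hence the whole tuple is fixed.
  have key (i) (hi : x i ∈ (matroid k K).closure {c}) : x i ∈ (matroid k K).closure ∅ := by
    by_contra hi'
    exact hx i j (indep₂_of_mem_of_notMem hi hi' hj)
  have hfix (i) : permOn τ.toEquiv _ h (x i) = x i := by
    by_cases hi : x i ∈ (matroid k K).closure {c}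
    · exact permOn_closure_of_mem_closure_empty (key i hi)
    · exact permOn_of_notMem hi
  exact ⟨AlgEquiv.refl, fun i ↦ (hfix i).symm, fun i ↦
    (Equiv.symm_apply_eq _).2 (hfix i).symm |>.symm⟩

end PartialAutomorphism
end CurveReduct

namespace CurveReduct

open Cardinal AlgebraicIndependent FirstOrder FirstOrder.Language

/-! ### Translating relational formulas into formulas with parameters -/

section Translation

variable {L L' : FirstOrder.Language.{0, 0}} [L'.IsRelational] {P : Type}

/-- The structure for a relational language on an `L`-structure `N` in which each relation symbol
is interpreted by an `L`-formula with parameters named by `P`. -/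
@[reducible]
def interpretedStructure (T : ∀ n, L'.Relations n → L.Formula (P ⊕ Fin n)) {N : Type}
    [L.Structure N] (f : P → N) : L'.Structure N where
  funMap g := isEmptyElim g
  RelMap r x := (T _ r).Realize (Sum.elim f x)

/-- Realization of a formula in the interpreted structure. -/
def InterpretedRealize (T : ∀ n, L'.Relations n → L.Formula (P ⊕ Fin n)) {N : Type}
    [L.Structure N] (f : P → N) {α : Type} (ψ : L'.Formula α) (v : α → N) : Prop :=
  let := interpretedStructure T f
  ψ.Realize v

/-- The variable which a term of a relational language is. -/
def termVar {α : Type} : L'.Term α → α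
  | .var i => i
  | .func g _ => isEmptyElim g

theorem realize_eq_termVar {α N : Type} [L'.Structure N] (t : L'.Term α) (v : α → N) :
    t.realize v = v (termVar t) := by
  cases t with
  | var => rfl
  | func g => exact isEmptyElim g

/-- A bounded formula over the interpreted structure translates to one with parameters over the
original language, uniformly over all structures. -/
theorem exists_translation_boundedFormula (T : ∀ n, L'.Relations n → L.Formula (P ⊕ Fin n))
    {α : Type} {n : ℕ} (ψ : L'.BoundedFormula α n) :
    ∃ θ : L.BoundedFormula (P ⊕ α) n, ∀ (N : Type) [L.Structure N] (f : P → N) (v : α → N)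
      (xs : Fin n → N), θ.Realize (Sum.elim f v) xs ↔
        @BoundedFormula.Realize L' N (interpretedStructure T f) α n ψ v xs := by
  induction ψ with
  | falsum => exact ⟨.falsum, fun N _ f v xs ↦ Iff.rfl⟩
  | @equal n t₁ t₂ =>
    let w (t : L'.Term (α ⊕ Fin n)) : L.Term ((P ⊕ α) ⊕ Fin n) :=
      .var (Sum.map Sum.inr id (termVar t))
    have hw (N : Type) [L.Structure N] (f : P → N) (v : α → N) xs (t) :
        (w t).realize (Sum.elim (Sum.elim f v) xs) = Sum.elim v xs (termVar t) := by
      change Sum.elim (Sum.elim f v) xs (Sum.map Sum.inr id (termVar t)) = _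
      cases termVar t <;> rfl
    refine ⟨.equal (w t₁) (w t₂), fun N _ f v xs ↦ ?_⟩
    let := interpretedStructure T f
    change (w t₁).realize _ = (w t₂).realize _ ↔ t₁.realize (Sum.elim v xs) = t₂.realize _
    rw [hw, hw, realize_eq_termVar, realize_eq_termVar]
  | @rel n l R ts =>
    refine ⟨BoundedFormula.relabel (Sum.elim (Sum.inl ∘ Sum.inl)
      fun i ↦ Sum.map Sum.inr id (termVar (ts i))) (T l R), fun N _ f v xs ↦ ?_⟩
    let := interpretedStructure T f
    change _ ↔ (T l R).Realize (Sum.elim f fun i ↦ (ts i).realize (Sum.elim v xs))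
    rw [BoundedFormula.realize_relabel, Formula.Realize]
    refine iff_of_eq (congrArg₂ _ (funext ?_) (Subsingleton.elim _ _))
    rintro (p | i)
    · rfl
    · change Sum.elim (Sum.elim f v) (xs ∘ Fin.castAdd 0) (Sum.map Sum.inr id (termVar (ts i))) =
        (ts i).realize (Sum.elim v xs)
      rw [realize_eq_termVar]
      cases termVar (ts i) <;> rfl
  | imp _ _ ih₁ ih₂ =>
    obtain ⟨θ₁, h₁⟩ := ih₁
    obtain ⟨θ₂, h₂⟩ := ih₂
    exact ⟨θ₁.imp θ₂, fun N _ f v xs ↦ imp_congr (h₁ N f v xs) (h₂ N f v xs)⟩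
  | all _ ih =>
    obtain ⟨θ, h⟩ := ih
    exact ⟨θ.all, fun N _ f v xs ↦ forall_congr' fun x ↦ h N f v (Fin.snoc xs x)⟩

/-- A formula over the interpreted structure translates to a formula with parameters over the
original language, uniformly over all structures. -/
theorem exists_translation (T : ∀ n, L'.Relations n → L.Formula (P ⊕ Fin n)) {α : Type}
    (ψ : L'.Formula α) :
    ∃ θ : L.Formula (P ⊕ α), ∀ (N : Type) [L.Structure N] (f : P → N) (v : α → N),
      θ.Realize (Sum.elim f v) ↔ InterpretedRealize T f ψ v := by
  obtain ⟨θ, hθ⟩ := exists_translation_boundedFormula T ψ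
  exact ⟨θ, fun N _ f v ↦ hθ N f v _⟩

theorem interpretedRealize_comp (T : ∀ n, L'.Relations n → L.Formula (P ⊕ Fin n)) {N : Type}
    [L.Structure N] {f : P → N} {σ : Equiv.Perm N}
    (hσ : ∀ n (R : L'.Relations n) x, (T n R).Realize (Sum.elim f (σ ∘ x)) ↔
      (T n R).Realize (Sum.elim f x)) {α : Type} (ψ : L'.Formula α) (v : α → N) :
    InterpretedRealize T f ψ (σ ∘ v) ↔ InterpretedRealize T f ψ v := by
  let := interpretedStructure T f
  let σ' : L'.Equiv N N :=
    { σ with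
      map_fun' := fun g ↦ isEmptyElim g
      map_rel' := fun R x ↦ hσ _ R x }
  exact StrongHomClass.realize_formula σ' ψ

end Translation

/-! ### A large elementary extension of ℂ -/

section ElementaryExtension

theorem exists_elementary_extension : ∃ (K : Type) (_ : Field K) (_ : Ring.CompatibleRing K)
    (_ : Algebra ℂ K) (f : ℂ ↪ₑ[ring] K), IsAlgClosed K ∧ (∀ z, f z = algebraMap ℂ K z) ∧
      #ℂ < #K := by
  obtain ⟨N, ⟨f⟩, hN⟩ := exists_elementaryEmbedding_card_eq_of_ge ring ℂ (Order.succ #ℂ) (by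
    simp only [Cardinal.lift_id, Ring.card_ring]
    exact (natCast_lt_aleph0 (n := 5)).le.trans
      ((aleph0_le_mk ℂ).trans (Order.le_succ _))) (by simpa using Order.le_succ _)
  have : (Theory.ACF 0).Model N := (f.theory_model_iff _).1 inferInstance
  have := Field.modelField_of_modelACF 0 N
  let := Field.fieldOfModelField N
  let := Field.compatibleRingOfModelField N
  have := Field.isAlgClosed_of_model_ACF 0 N
  let φ : ℂ →+* N :=
    { toFun := f
      map_one' := by simpa using f.map_fun (Ring.oneFunc) ![]
      map_zero' := by simpa using f.map_fun (Ring.zeroFunc) ![]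
      map_add' := fun x y ↦ by simpa using f.map_fun Ring.addFunc ![x, y]
      map_mul' := fun x y ↦ by simpa using f.map_fun Ring.mulFunc ![x, y] }
  refine ⟨N, inferInstance, inferInstance, φ.toAlgebra, f, inferInstance, fun z ↦ rfl, ?_⟩
  rw [hN]
  exact Order.lt_succ _

end ElementaryExtension
end CurveReduct

namespace CurveReduct

open Cardinal AlgebraicIndependent FirstOrder FirstOrder.Language

/-! ### Model-theoretic dimension and invariance of the basic relations -/

section Automorphisms

variable {K : Type} [Field K] [Ring.CompatibleRing K] [Algebra ℂ K]

theorem realize_algEquiv_comp (g : K ≃ₐ[ℂ] K) {P α : Type} (φ : ring.Formula (P ⊕ α)) (p : P → K)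
    (hp : ∀ i, g (p i) = p i) (x : α → K) :
    φ.Realize (Sum.elim p (g ∘ x)) ↔ φ.Realize (Sum.elim p x) := by
  have h := StrongHomClass.realize_formula
    (Ring.languageEquivEquivRingEquiv.symm g.toRingEquiv) φ (v := Sum.elim p x)
  rw [← h]
  refine iff_of_eq (congrArg _ (funext ?_))
  rintro (i | i)
  · exact (hp i).symm
  · rfl

/-- The set of automorphic images of a model-theoretically algebraic element is finite. -/
theorem finite_of_mem_acl {A : Set K} {b : K} (hb : b ∈ acl ring A) :
    {y | ∃ g : K ≃ₐ[ℂ] K, (∀ a ∈ A, g a = a) ∧ g b = y}.Finite := by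
  obtain ⟨s, hs, hfin, hbs⟩ := hb
  refine hfin.subset ?_
  rintro _ ⟨g, hg, rfl⟩
  obtain ⟨φ, hφ⟩ := Set.definable_iff_exists_formula_sum.1 hs
  have mem (y : K) : y ∈ s ↔ φ.Realize (Sum.elim (↑) fun _ : Fin 1 ↦ y) := by
    change (fun _ : Fin 1 ↦ y) ∈ {x : Fin 1 → K | x 0 ∈ s} ↔ _
    rw [hφ]
    rfl
  rw [mem] at hbs ⊢
  exact (realize_algEquiv_comp g φ _ (fun i ↦ hg i i.2) _).2 hbs

variable [IsAlgClosed K]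

omit [Ring.CompatibleRing K] [IsAlgClosed K] in
theorem infinite_range_add_coe (x : K) : (Set.range fun r : ℂ ↦ x + algebraMap ℂ K r).Infinite :=
  Set.infinite_range_of_injective fun _ _ h ↦ (algebraMap ℂ K).injective (add_left_cancel h)

/-- All translates of `x` by ℂ are conjugate to `x` over ℂ, whereas an algebraic element has
finitely many conjugates. -/
theorem notMem_acl_left {x y : K} (h : Indep₂ ℂ x y) :
    x ∉ acl ring (Set.range (algebraMap ℂ K)) := by
  refine fun hx ↦ infinite_range_add_coe x ((finite_of_mem_acl hx).subset ?_)
  rintro _ ⟨r, rfl⟩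
  obtain ⟨g, hg, -⟩ := exists_algEquiv_of_indep₂ h (h.add_coe r 0)
  refine ⟨g, ?_, hg⟩
  rintro _ ⟨z, rfl⟩
  exact g.commutes z

theorem notMem_acl_right {x y : K} (h : Indep₂ ℂ x y) :
    y ∉ acl ring (Set.range (algebraMap ℂ K) ∪ {x}) := by
  refine fun hy ↦ infinite_range_add_coe y ((finite_of_mem_acl hy).subset ?_)
  rintro _ ⟨r, rfl⟩
  obtain ⟨g, hx, hg⟩ := exists_algEquiv_of_indep₂ h (h.add_coe 0 r)
  refine ⟨g, ?_, hg⟩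
  rintro _ (⟨z, rfl⟩ | rfl)
  · exact g.commutes z
  · simpa using hx

/-- The entries of a tuple on a curve are pairwise algebraically dependent. -/
theorem not_indep₂_of_dimLE_one {f : ℂ ↪ₑ[ring] K} (hf : ∀ z, f z = algebraMap ℂ K z) {n : ℕ}
    {φ : ring.Formula (ℂ ⊕ Fin n)} (hφ : DimLE ring φ 1) {x : Fin n → K}
    (hx : φ.Realize (Sum.elim f x)) (i j : Fin n) : ¬ Indep₂ ℂ (x i) (x j) := by
  intro h
  have hrange : Set.range f = Set.range (algebraMap ℂ K) := congrArg Set.range (funext hf)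
  refine absurd (hφ 2 ⟨K, inferInstance, f, x, ![i, j], hx, fun l ↦ ?_⟩) (by norm_num)
  rw [hrange]
  fin_cases l
  · have : {b | ∃ k < (0 : Fin 2), b = x (![i, j] k)} = ∅ := by ext; simp
    simpa [this] using notMem_acl_left h
  · have : {b | ∃ k < (1 : Fin 2), b = x (![i, j] k)} = {x i} := by ext; simp
    simpa [this] using notMem_acl_right h

theorem realize_comp_of_dimLE_one {f : ℂ ↪ₑ[ring] K} (hf : ∀ z, f z = algebraMap ℂ K z) {n : ℕ}
    {φ : ring.Formula (ℂ ⊕ Fin n)} (hφ : DimLE ring φ 1) {τ : K ≃ₐ[ℂ] K} {c : K}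
    (h : ∀ x, τ x ∈ (matroid ℂ K).closure {c} ↔ x ∈ (matroid ℂ K).closure {c}) (x : Fin n → K) :
    φ.Realize (Sum.elim f (permOn τ.toEquiv _ h ∘ x)) ↔ φ.Realize (Sum.elim f x) := by
  have hg (g : K ≃ₐ[ℂ] K) (z) : g (f z) = f z := by rw [hf]; exact g.commutes z
  -- Dependence is known only for the tuple satisfying `φ`. In the forward direction this is the
  -- image tuple, which is why the inverse permutation must also agree with an automorphism.
  refine ⟨fun hx ↦ ?_, fun hx ↦ ?_⟩ <;>
    obtain ⟨g, hg₁, hg₂⟩ :=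
      exists_algEquiv_eq_permOn_of_dependent (h := h) (not_indep₂_of_dimLE_one hf hφ hx)
  · have hgx : g.symm ∘ (permOn τ.toEquiv _ h ∘ x) = x := by
      ext i
      simpa using hg₂ i
    rw [← realize_algEquiv_comp g.symm φ f (hg _), hgx] at hx
    exact hx
  · have hgx : g ∘ x = permOn τ.toEquiv _ h ∘ x := funext hg₁
    rwa [← hgx, realize_algEquiv_comp g φ f (hg _)]

theorem realize_comp_of_binary {f : ℂ ↪ₑ[ring] K} (hf : ∀ z, f z = algebraMap ℂ K z)
    (φ : ring.Formula (ℂ ⊕ Fin 2)) {τ : K ≃ₐ[ℂ] K} {c : K}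
    (h : ∀ x, τ x ∈ (matroid ℂ K).closure {c} ↔ x ∈ (matroid ℂ K).closure {c}) (x : Fin 2 → K) :
    φ.Realize (Sum.elim f (permOn τ.toEquiv _ h ∘ x)) ↔ φ.Realize (Sum.elim f x) := by
  obtain ⟨g, hg₀, hg₁⟩ := exists_algEquiv_eq_permOn (h := h) (x 0) (x 1)
  have hgx : g ∘ x = permOn τ.toEquiv _ h ∘ x := by
    ext i
    fin_cases i
    · exact hg₀
    · exact hg₁
  rw [← hgx, realize_algEquiv_comp g φ f fun z ↦ ?_]
  rw [hf]
  exact g.commutes z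

end Automorphisms

/-! ### Criterion for a proper reduct -/

section ProperReduct

variable {L' : FirstOrder.Language.{0, 0}} [L'.IsRelational] [L'.Structure ℂ]
  {T : ∀ n, L'.Relations n → ring.Formula (ℂ ⊕ Fin n)}

theorem interpretedRealize_iff
    (hT : ∀ n (R : L'.Relations n) x, Structure.RelMap R x ↔ (T n R).Realize (Sum.elim id x))
    {α : Type} (ψ : L'.Formula α) (v : α → ℂ) :
    InterpretedRealize T id ψ v ↔ ψ.Realize v := by
  have : interpretedStructure T id = ‹L'.Structure ℂ› := by
    ext n g x
    · exact isEmptyElim g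
    · exact (hT _ g x).symm
  unfold InterpretedRealize
  rw [this]

theorem isReduct_of_relMap_iff
    (hT : ∀ n (R : L'.Relations n) x, Structure.RelMap R x ↔ (T n R).Realize (Sum.elim id x)) :
    IsReduct L' ring ℂ := by
  intro n X hX
  obtain ⟨ψ, rfl⟩ := Set.definable_iff_exists_formula_sum.1 hX
  obtain ⟨θ, hθ⟩ := exists_translation T ψ
  let r : ℂ ⊕ ((Set.univ : Set ℂ) ⊕ Fin n) → (Set.univ : Set ℂ) ⊕ Fin n :=
    Sum.elim (fun z ↦ Sum.inl ⟨z, trivial⟩) id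
  refine Set.definable_iff_exists_formula_sum.2 ⟨Formula.relabel r θ, ?_⟩
  ext x
  have hr : Sum.elim (fun z : (Set.univ : Set ℂ) ↦ (z : ℂ)) x ∘ r = Sum.elim id (Sum.elim (↑) x) := by
    ext (z | z) <;> rfl
  change ψ.Realize _ ↔ (Formula.relabel r θ).Realize _
  rw [Formula.realize_relabel, hr, ← interpretedRealize_iff hT]
  exact (hθ ℂ id _).symm

/-- The graph of addition. -/
noncomputable def addFormula : ring.Formula (Fin 3) :=
  Term.equal (Term.var 0 + Term.var 1) (Term.var 2)

theorem realize_addFormula {K : Type} [Field K] [Ring.CompatibleRing K] (x : Fin 3 → K) :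
    addFormula.Realize x ↔ x 0 + x 1 = x 2 := by
  simp [addFormula, Formula.realize_equal]

/-- Formulas with parameters which are equivalent in `M` are equivalent in each elementary
extension. -/
theorem realize_iff_of_elementary {L : FirstOrder.Language.{0, 0}} {M N : Type} [L.Structure M]
    [L.Structure N] (f : M ↪ₑ[L] N) {β : Type} [Finite β] {φ ψ : L.Formula (M ⊕ β)}
    (h : ∀ x, φ.Realize (Sum.elim id x) ↔ ψ.Realize (Sum.elim id x)) (x : β → N) :
    φ.Realize (Sum.elim f x) ↔ ψ.Realize (Sum.elim f x) := by
  have hM : (Formula.iAlls β (φ.iff ψ)).Realize (id : M → M) :=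
    Formula.realize_iAlls.2 fun x ↦ Formula.realize_iff.2 (h x)
  exact Formula.realize_iff.1 (Formula.realize_iAlls.1 ((f.map_formula _ id).2 hM) x)

theorem exists_indep₂ {K : Type} [Field K] [Algebra ℂ K] [IsAlgClosed K] (hK : #ℂ < #K) :
    ∃ x y : K, Indep₂ ℂ x y := by
  obtain ⟨B, hB⟩ := exists_isTranscendenceBasis ℂ K
  have hnt : B.Nontrivial := by
    by_contra hB'
    -- A transcendence basis with at most one element would force #K ≤ #ℂ.
    refine hK.not_ge ((IsAlgClosed.cardinal_le_max_transcendence_basis' _ hB).trans ?_)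
    have : #B ≤ ℵ₀ := (Set.not_nontrivial_iff.1 hB').finite.lt_aleph0.le
    exact max_le (max_le le_rfl (this.trans (aleph0_le_mk ℂ))) (aleph0_le_mk ℂ)
  obtain ⟨x, hx, y, hy, hxy⟩ := hnt
  have hI : (matroid ℂ K).Indep B := hB.1
  have hxyI : (matroid ℂ K).Indep {x, y} := hI.subset (Set.pair_subset hx hy)
  have hxI : (matroid ℂ K).Indep {x} := hI.subset (Set.singleton_subset_iff.2 hx)
  refine ⟨x, y, ?_, ?_⟩
  · simpa using hxI.notMem_closure_sdiff_of_mem rfl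
  · have := hxyI.notMem_closure_sdiff_of_mem (e := y) (by simp)
    rwa [Set.pair_sdiff_right hxy] at this

/-- Any definition of addition in the reduct would be invariant under `permOn τ`, which breaks `(c -
b) + b = c`. -/
theorem not_isReduct_of_invariant
    (hT : ∀ n (R : L'.Relations n) x, Structure.RelMap R x ↔ (T n R).Realize (Sum.elim id x))
    (hinv : ∀ (K : Type) [Field K] [Ring.CompatibleRing K] [Algebra ℂ K] [IsAlgClosed K]
      (f : ℂ ↪ₑ[ring] K), (∀ z, f z = algebraMap ℂ K z) → ∀ (τ : K ≃ₐ[ℂ] K) (c : K)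
      (h : ∀ x, τ x ∈ (matroid ℂ K).closure {c} ↔ x ∈ (matroid ℂ K).closure {c}) n
      (R : L'.Relations n) x, (T n R).Realize (Sum.elim f (permOn τ.toEquiv _ h ∘ x)) ↔
        (T n R).Realize (Sum.elim f x)) :
    ¬ IsReduct ring L' ℂ := by
  intro H
  have hadd : (Set.univ : Set ℂ).Definable ring {x : Fin 3 → ℂ | x 0 + x 1 = x 2} := by
    refine Set.definable_iff_exists_formula_sum.2 ⟨addFormula.relabel Sum.inr, ?_⟩
    ext x
    change _ ↔ (addFormula.relabel Sum.inr).Realize _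
    rw [Formula.realize_relabel, realize_addFormula]
    rfl
  obtain ⟨ψ, hψ⟩ := Set.definable_iff_exists_formula_sum.1 (H 3 _ hadd)
  obtain ⟨θ, hθ⟩ := exists_translation T ψ
  obtain ⟨K, _, _, _, f, _, hf, hcard⟩ := exists_elementary_extension
  obtain ⟨c, b, hcb⟩ := exists_indep₂ hcard
  obtain ⟨τ, hτ, -⟩ := exists_algEquiv_of_indep₂ hcb (hcb.add_coe 1 0)
  have hcl : (matroid ℂ K).closure {τ c} = (matroid ℂ K).closure {c} := by
    rw [hτ, closure_singleton_add_coe]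
  have h (x : K) : τ x ∈ (matroid ℂ K).closure {c} ↔ x ∈ (matroid ℂ K).closure {c} := by
    refine ⟨fun hx ↦ ?_, fun hx ↦ hcl ▸ apply_mem_closure τ hx⟩
    rw [← hcl] at hx
    simpa using apply_mem_closure τ.symm hx
  let r : ℂ ⊕ ((Set.univ : Set ℂ) ⊕ Fin 3) → ℂ ⊕ Fin 3 :=
    Sum.elim Sum.inl (Sum.map (↑) id)
  have hr {N : Type} (p : ℂ → N) (x : Fin 3 → N) :
      Sum.elim p x ∘ r = Sum.elim p (Sum.elim (fun z : (Set.univ : Set ℂ) ↦ p z) x) := by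
    ext (z | z | z) <;> rfl
  -- The equivalence holds over ℂ by the choice of `ψ`; its ring translation carries it to `K`.
  have key (x : Fin 3 → K) :
      InterpretedRealize T f ψ (Sum.elim (fun z : (Set.univ : Set ℂ) ↦ f z) x) ↔
        x 0 + x 1 = x 2 := by
    have h₁ := realize_iff_of_elementary f (φ := Formula.relabel r θ)
      (ψ := addFormula.relabel Sum.inr) (fun x ↦ ?_) x
    · rw [Formula.realize_relabel, Formula.realize_relabel, hr, realize_addFormula] at h₁
      exact (hθ K f _).symm.trans h₁
    · rw [Formula.realize_relabel, Formula.realize_relabel, hr, realize_addFormula]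
      have hx : x ∈ {x : Fin 3 → ℂ | x 0 + x 1 = x 2} ↔ ψ.Realize (Sum.elim (↑) x) := by
        rw [hψ]
        rfl
      exact (hθ ℂ id _).trans ((interpretedRealize_iff hT ψ _).trans hx.symm)
  have hc : c ∈ (matroid ℂ K).closure {c} := Matroid.mem_closure_of_mem _ rfl
  have hσ := (key ![c - b, b, c]).2 (by simp)
  rw [← interpretedRealize_comp T (hinv K f hf τ c h)] at hσ
  have hcomp : permOn τ.toEquiv _ h ∘
      Sum.elim (fun z : (Set.univ : Set ℂ) ↦ f z) ![c - b, b, c] =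
      Sum.elim (fun z : (Set.univ : Set ℂ) ↦ f z) (permOn τ.toEquiv _ h ∘ ![c - b, b, c]) := by
    rw [Sum.comp_elim]
    congr 1
    ext z
    simp only [Function.comp_apply, hf]
    exact permOn_coe _
  rw [hcomp, key] at hσ
  have hsub : c - b ∉ (matroid ℂ K).closure {c} := fun hmem ↦ hcb.2 <| by
    simpa using add_mem_closure hc (neg_mem_closure hmem)
  change permOn τ.toEquiv _ h (c - b) + permOn τ.toEquiv _ h b = permOn τ.toEquiv _ h c at hσ
  rw [permOn_of_notMem hsub, permOn_of_notMem hcb.2, permOn_of_mem hc] at hσ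
  change c - b + b = τ c at hσ
  rw [hτ] at hσ
  simp at hσ

theorem isProperReduct_of_invariant
    (hT : ∀ n (R : L'.Relations n) x, Structure.RelMap R x ↔ (T n R).Realize (Sum.elim id x))
    (hinv : ∀ (K : Type) [Field K] [Ring.CompatibleRing K] [Algebra ℂ K] [IsAlgClosed K]
      (f : ℂ ↪ₑ[ring] K), (∀ z, f z = algebraMap ℂ K z) → ∀ (τ : K ≃ₐ[ℂ] K) (c : K)
      (h : ∀ x, τ x ∈ (matroid ℂ K).closure {c} ↔ x ∈ (matroid ℂ K).closure {c}) n
      (R : L'.Relations n) x, (T n R).Realize (Sum.elim f (permOn τ.toEquiv _ h ∘ x)) ↔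
        (T n R).Realize (Sum.elim f x)) :
    IsProperReduct L' ring ℂ :=
  ⟨isReduct_of_relMap_iff hT, not_isReduct_of_invariant hT hinv⟩

end ProperReduct

/-! ### The curve and binary structures -/

section Instances

variable (L : FirstOrder.Language.{0, 0}) (M : Type) [L.Structure M]

instance : (curveLang L M).IsRelational := fun _ ↦ inferInstanceAs (IsEmpty Empty)

instance : (binaryLang L M).IsRelational := fun _ ↦ inferInstanceAs (IsEmpty Empty)

variable {L M}

theorem exists_formula_of_definable_univ {n : ℕ} {X : Set (Fin n → M)}
    (hX : (Set.univ : Set M).Definable L X) :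
    ∃ φ : L.Formula (M ⊕ Fin n), ∀ x, x ∈ X ↔ φ.Realize (Sum.elim id x) := by
  obtain ⟨φ, rfl⟩ := Set.definable_iff_exists_formula_sum.1 hX
  refine ⟨φ.relabel (Sum.map (↑) id), fun x ↦ ?_⟩
  rw [Formula.realize_relabel, Sum.elim_comp_map]
  rfl

end Instances

theorem isProperReduct_curveLang : IsProperReduct (curveLang ring ℂ) ring ℂ := by
  choose φ hφ hdim using fun n (R : (curveLang ring ℂ).Relations n) ↦ R.2
  exact isProperReduct_of_invariant (T := φ) (fun n R x ↦ hφ n R x)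
    fun K _ _ _ _ f hf τ c h n R x ↦ realize_comp_of_dimLE_one hf (hdim n R) h x

theorem isProperReduct_binaryLang : IsProperReduct (binaryLang ring ℂ) ring ℂ := by
  choose φ hφ using fun n (R : (binaryLang ring ℂ).Relations n) ↦
    exists_formula_of_definable_univ R.2.2
  refine isProperReduct_of_invariant (T := φ) (fun n R x ↦ hφ n R x)
    fun K _ _ _ _ f hf τ c h n R x ↦ ?_
  obtain rfl : n = 2 := R.2.1
  exact realize_comp_of_binary hf (φ 2 R) h x

end CurveReduct

theorem corollary3p9 :
    CurveReduct.IsProperReduct (CurveReduct.curveLang FirstOrder.Language.ring ℂ) FirstOrder.Language.ring ℂ ∧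
      CurveReduct.IsProperReduct (CurveReduct.binaryLang FirstOrder.Language.ring ℂ) FirstOrder.Language.ring ℂ :=
  ⟨CurveReduct.isProperReduct_curveLang, CurveReduct.isProperReduct_binaryLang⟩
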